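/- A graph is an undirected graph in which multiple edges and loops are allowed; every edge, also a loop, gives rise to two distinct, mutually inverse directed edges $e,\overline e$. A graph is $d$-regular if every vertex is the origin of exactly $d$ directed edges, and the entry $(a,b)$ of its adjacency matrix $A$ is the number of directed edges from $a$ to $b$. The girth of a graph is the length $r\ge 1$ of a shortest closed walk $e_0,\dots,e_{r-1}$ with $e_i\neq\overline{e_{i+1}}$ for $0\le i\le r-2$ (and $\infty$ if there is none). Let $(G_n)_{n\ge 0}$ be a sequence of finite non-empty graphs $G_n=(V_n,E_n)$, where $G_n$ is $(q_n+1)$-regular with $q_n\in\mathbb{N}=\{0,1,2,\dots\}$, has adjacency matrix $A_n$ and girth $g_n$. Let $$\mu(G_n)=\frac1{|V_n|}\sum_{k=1}^{|V_n|}\delta_{q_n^{-1/2}\lambda_k(A_n)}$$ be its normalized spectral measure, where $\lambda_1(A_n),\dots,\lambda_{|V_n|}(A_n)$ are the eigenvalues of $A_n$ with multiplicity (for the finitely many irrelevant $n$ with $q_n=0$, read $q_n^{-1/2}$ as $0$). Let $\mu_\infty$ be the semicircle distribution $d\mu_\infty(x)=\frac1{2\pi}\sqrt{4-x^2}\,\mathbf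 1_{|x|\le 2}\,dx$. If $q_n+1\to\infty$ and $g_n\to\infty$ as $n\to\infty$, then for every $p\in[1,\infty)$ the measures $\mu(G_n)$ converge to $\mu_\infty$ in $P_p(\mathbb{R})$, the space of probability measures on $\mathbb{R}$ with finite $p$-th absolute moment with the distance $$W_p(\mu,\nu)=\inf_{\gamma}\Big(\int_{\mathbb{R}^2}|x-y|^p\,d\gamma(x,y)\Big)^{1/p},$$ the infimum being over all couplings $\gamma$ of $\mu$ and $\nu$; that is, all $\mu(G_n)$ and $\mu_\infty$ belong to $P_p(\mathbb{R})$ and $W_p(\mu(G_n),\mu_\infty)\to 0$. -/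

import Mathlib

open MeasureTheory Filter Topology
open scoped ENNReal

/-- An undirected graph with vertex set `V`, possibly with multiple edges and loops, given by its
set `E` of directed edges: every undirected edge (also a loop) is a pair `{e, inv e}` of two
distinct, mutually inverse directed edges. -/
structure Multigraph (V E : Type*) where
  /-- origin of a directed edge -/
  org : E → V
  /-- terminus of a directed edge -/
  ter : E → V
  /-- inverse of a directed edge -/
  inv : E → E
  inv_inv : ∀ e, inv (inv e) = e
  inv_ne : ∀ e, inv e ≠ e
  org_inv : ∀ e, org (inv e) = ter e

namespace Multigraph

variable {V E : Type*} (G : Multigraph V E)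

/-- The list of directed edges `l` is a walk from `a` to `b`; the empty list is the trivial walk. -/
def IsWalk : V → V → List E → Prop
  | a, b, [] => a = b
  | a, b, e :: l => G.org e = a ∧ IsWalk (G.ter e) b l

/-- A walk `e₀, e₁, …` is non-backtracking if `eᵢ ≠ inv eᵢ₊₁` for all consecutive edges. -/
def IsNonBacktracking (l : List E) : Prop :=
  l.IsChain (fun e f => e ≠ G.inv f)

/-- `l` is a nontrivial closed non-backtracking walk (of length `l.length`). There is no condition
on the last and the first edge. -/
def IsNontrivialClosedNBW (l : List E) : Prop :=
  l ≠ [] ∧ (∃ a, G.IsWalk a a l) ∧ G.IsNonBacktracking l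

/-- The girth: the length of a shortest nontrivial closed non-backtracking walk
(`⊤` if there is none). -/
noncomputable def girth : ℕ∞ :=
  ⨅ l ∈ {l : List E | G.IsNontrivialClosedNBW l}, (l.length : ℕ∞)

variable [Fintype E] [DecidableEq V]

/-- `G` is `d`-regular: every vertex is the origin of exactly `d` directed edges
(so a loop contributes two to the degree). -/
def IsRegular (d : ℕ) : Prop :=
  ∀ v, (Finset.univ.filter (fun e => G.org e = v)).card = d

/-- The adjacency matrix: the entry `(a, b)` is the number of directed edges from `a` to `b`. -/
def adjMatrix : Matrix V V ℝ :=
  Matrix.of fun a b => ((Finset.univ.filter (fun e => G.org e = a ∧ G.ter e = b)).card : ℝ)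

theorem adjMatrix_isHermitian : G.adjMatrix.IsHermitian := by
  have hter : ∀ e, G.ter (G.inv e) = G.org e := fun e => by
    rw [← G.org_inv, G.inv_inv]
  ext a b
  simp only [adjMatrix, Matrix.conjTranspose_apply, Matrix.of_apply, star_trivial, Nat.cast_inj]
  refine Finset.card_bij' (fun e _ => G.inv e) (fun e _ => G.inv e) ?_ ?_ ?_ ?_ <;>
    simp +contextual [G.inv_inv, G.org_inv, hter]

/-- The normalized spectral measure `|V|⁻¹ ∑ₖ δ_{q^{-1/2} λₖ}` of a finite `(q+1)`-regular graph,
where the `λₖ` are the `|V|` eigenvalues of the adjacency matrix, with multiplicity. -/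
noncomputable def spectralMeasure [Fintype V] (q : ℕ) : Measure ℝ :=
  (Fintype.card V : ℝ≥0∞)⁻¹ •
    ∑ k : V, Measure.dirac ((q : ℝ) ^ (-(1 / 2 : ℝ)) * G.adjMatrix_isHermitian.eigenvalues k)

end Multigraph

/-- The semicircle distribution `(2π)⁻¹ √(4 - x²) 1_{|x| ≤ 2} dx`. -/
noncomputable def semicircle : Measure ℝ :=
  volume.withDensity fun x =>
    ENNReal.ofReal (Set.indicator {x : ℝ | |x| ≤ 2}
      (fun x => 1 / (2 * Real.pi) * Real.sqrt (4 - x ^ 2)) x)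

/-- `μ` belongs to the Wasserstein space `P_p(ℝ)`: it is a probability measure with finite
`p`-th absolute moment. -/
def MemWassersteinSpace (p : ℝ) (μ : Measure ℝ) : Prop :=
  IsProbabilityMeasure μ ∧ ∫⁻ x, ENNReal.ofReal (|x| ^ p) ∂μ < ∞

/-- `γ` is a coupling of `μ` and `ν`, i.e. its marginals are `μ` and `ν`. -/
def IsCoupling (μ ν : Measure ℝ) (γ : Measure (ℝ × ℝ)) : Prop :=
  γ.map Prod.fst = μ ∧ γ.map Prod.snd = ν

/-- The Wasserstein distance `W_p(μ, ν) = inf_γ (∫ |x - y|^p dγ)^{1/p}`, with values in `[0, ∞]`. -/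
noncomputable def wassersteinDist (p : ℝ) (μ ν : Measure ℝ) : ℝ≥0∞ :=
  ⨅ γ ∈ {γ : Measure (ℝ × ℝ) | IsCoupling μ ν γ},
    (∫⁻ z, ENNReal.ofReal (|z.1 - z.2| ^ p) ∂γ) ^ (1 / p)

/-- `μₙ → μ` in the metric space `(P_p(ℝ), W_p)`. -/
def TendstoInWassersteinSpace (p : ℝ) (μs : ℕ → Measure ℝ) (μ : Measure ℝ) : Prop :=
  (∀ n, MemWassersteinSpace p (μs n)) ∧ MemWassersteinSpace p μ ∧
    Tendsto (fun n => wassersteinDist p (μs n) μ) atTop (𝓝 0)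

/-! Let `A_r` be the matrix counting non-backtracking walks of length `r`. Regularity gives `A A_1 =
A_2 + (q+1)` and `A A_r = A_{r+1} + q A_{r-1}` for `r ≥ 2`. After scaling by `c = q^{-1/2}` this is
the Chebyshev recursion, up to a defect in the first step: `S_{r+2}(cA) = c^{r+2} A_{r+2} + q⁻¹
S_r(cA)` (`aeval_chebyshev_adjMatrix`). Below the girth `A_{r+2}` has zero diagonal, so taking
traces yields `∫ S_{r+2} dμ = q⁻¹ ∫ S_r dμ`, which tends to 0. The semicircle law satisfies `∫ S_r =
δ_{r0}`, and the `S_r` span the polynomials; hence all moments converge.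

As the limit has compact support, convergence of moments forces convergence of characteristic
functions, hence of distribution functions (`tendsto_cdf_of_tendsto_moments`). Then the quantile
functions converge almost everywhere on `(0,1)`. They couple the measures, and bounded higher
moments upgrade this to convergence in every `L^p` (`tendsto_wassersteinDist`). -/

namespace Multigraph

variable {V E : Type*} (G : Multigraph V E)

theorem ter_inv (e : E) : G.ter (G.inv e) = G.org e := by
  rw [← G.org_inv, G.inv_inv]

/-! ### Non-backtracking walks and Chebyshev polynomials of the adjacency matrix -/

section NonBacktracking

variable [Fintype E] [DecidableEq V]

open Classical in
/-- The number of non-backtracking walks of length `r + 1` that start with the directed edge `e`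
and end at `b`. -/
noncomputable def nbwFrom : ℕ → E → V → ℝ
  | 0, e, b => if G.ter e = b then 1 else 0
  | r + 1, e, b => ∑ f with G.org f = G.ter e, if f = G.inv e then 0 else nbwFrom r f b

/-- The matrix of the numbers of non-backtracking walks of length `r` between two vertices. -/
noncomputable def nbwMatrix : ℕ → Matrix V V ℝ
  | 0 => 1
  | r + 1 => Matrix.of fun a b => ∑ e with G.org e = a, G.nbwFrom r e b

theorem exists_walk_of_nbwFrom_ne_zero {r : ℕ} {e : E} {b : V} (h : G.nbwFrom r e b ≠ 0) :
    ∃ l : List E, l.length = r ∧ G.IsWalk (G.org e) b (e :: l) ∧ G.IsNonBacktracking (e :: l) := by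
  induction r generalizing e with
  | zero =>
    refine ⟨[], rfl, ⟨rfl, ?_⟩, List.isChain_singleton _⟩
    by_contra h'
    exact h (if_neg h')
  | succ r ih =>
    obtain ⟨f, hf, hne⟩ := Finset.exists_ne_zero_of_sum_ne_zero h
    rw [Finset.mem_filter] at hf
    split_ifs at hne with hfe
    · exact absurd rfl hne
    obtain ⟨l, hl, hw, hc⟩ := ih hne
    refine ⟨f :: l, by simp [hl], ⟨rfl, ?_⟩, List.IsChain.cons_cons ?_ hc⟩
    · rw [← hf.2]; exact hw
    · rintro rfl
      exact hfe (G.inv_inv f).symm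

theorem nbwMatrix_diag_eq_zero {r : ℕ} (h : ((r + 1 : ℕ) : ℕ∞) < G.girth) (a : V) :
    G.nbwMatrix (r + 1) a a = 0 := by
  refine Finset.sum_eq_zero fun e he => ?_
  by_contra hne
  obtain ⟨l, hl, hw, hc⟩ := G.exists_walk_of_nbwFrom_ne_zero hne
  rw [(Finset.mem_filter.1 he).2] at hw
  have : G.girth ≤ ((e :: l).length : ℕ∞) :=
    iInf₂_le (e :: l) ⟨by simp, ⟨a, hw⟩, hc⟩
  rw [List.length_cons, hl] at this
  exact absurd h this.not_gt

theorem nbwMatrix_one : G.nbwMatrix 1 = G.adjMatrix := by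
  ext a b
  simp [nbwMatrix, nbwFrom, adjMatrix, Finset.filter_filter]

/-- Among the edges leaving `ter e`, only `inv e` is a forbidden continuation of `e`; it accounts
for the last term. -/
theorem sum_nbwFrom_ter (r : ℕ) (e : E) (b : V) :
    ∑ f with G.org f = G.ter e, G.nbwFrom r f b
      = G.nbwFrom (r + 1) e b + G.nbwFrom r (G.inv e) b := by
  classical
  have h : G.inv e ∈ Finset.univ.filter fun f => G.org f = G.ter e := by simp [G.org_inv]
  rw [nbwFrom, ← Finset.add_sum_erase _ _ h, ← Finset.add_sum_erase _ _ h, if_pos rfl, zero_add,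
    add_comm]
  congr 1
  refine Finset.sum_congr rfl fun f hf => ?_
  rw [if_neg (Finset.ne_of_mem_erase hf)]

variable [Fintype V]

theorem adjMatrix_mul_apply (M : Matrix V V ℝ) (a b : V) :
    (G.adjMatrix * M) a b = ∑ e with G.org e = a, M (G.ter e) b := by
  rw [Matrix.mul_apply, ← Finset.sum_fiberwise _ G.ter]
  refine Finset.sum_congr rfl fun c _ => ?_
  rw [Finset.filter_filter, Finset.sum_congr rfl (g := fun _ => M c b)]
  · simp [adjMatrix]
  · intro e he
    rw [(Finset.mem_filter.1 he).2.2]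

theorem adjMatrix_mul_nbwMatrix_apply (r : ℕ) (a b : V) :
    (G.adjMatrix * G.nbwMatrix (r + 1)) a b
      = G.nbwMatrix (r + 2) a b + ∑ e with G.org e = a, G.nbwFrom r (G.inv e) b := by
  rw [adjMatrix_mul_apply, nbwMatrix, nbwMatrix]
  simp only [Matrix.of_apply, sum_nbwFrom_ter, Finset.sum_add_distrib]

theorem adjMatrix_mul_nbwMatrix_one {d : ℕ} (hG : G.IsRegular d) :
    G.adjMatrix * G.nbwMatrix 1 = G.nbwMatrix 2 + (d : ℝ) • 1 := by
  ext a b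
  rw [adjMatrix_mul_nbwMatrix_apply, Matrix.add_apply, Matrix.smul_apply, Matrix.one_apply]
  congr 1
  rw [Finset.sum_congr rfl (g := fun _ => if a = b then (1 : ℝ) else 0)]
  · simp [hG a]
  · intro e he
    rw [nbwFrom, ter_inv, (Finset.mem_filter.1 he).2]

theorem adjMatrix_mul_nbwMatrix {q : ℕ} (hG : G.IsRegular (q + 1)) (r : ℕ) :
    G.adjMatrix * G.nbwMatrix (r + 2) = G.nbwMatrix (r + 3) + (q : ℝ) • G.nbwMatrix (r + 1) := by
  classical
  ext a b
  rw [adjMatrix_mul_nbwMatrix_apply, Matrix.add_apply, Matrix.smul_apply]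
  congr 1
  -- After `inv e`, which ends at `a`, a walk may continue along any edge at `a` except `e`. Summed
  -- over the `q + 1` edges `e` at `a`, each walk from `a` is thus counted `q` times.
  have h : ∀ e ∈ Finset.univ.filter (fun e => G.org e = a), G.nbwFrom (r + 1) (G.inv e) b
      = G.nbwMatrix (r + 1) a b - G.nbwFrom r e b := by
    intro e he
    have := G.sum_nbwFrom_ter r (G.inv e) b
    rw [ter_inv, inv_inv, (Finset.mem_filter.1 he).2] at this
    rw [nbwMatrix, Matrix.of_apply, this, add_sub_cancel_right]
  rw [Finset.sum_congr rfl h, Finset.sum_sub_distrib, Finset.sum_const, hG a]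
  simp [nbwMatrix]
  ring

-- Both sides obey the three-term recursion of `S`. The walk matrices do so only from length 2 on,
-- so `r = 0` and `r = 1` are treated separately.
open Polynomial Polynomial.Chebyshev in
theorem aeval_chebyshev_adjMatrix {q : ℕ} (hG : G.IsRegular (q + 1)) {c : ℝ} (hc : c ^ 2 * q = 1)
    (r : ℕ) :
    aeval (c • G.adjMatrix) (S ℝ (r + 2))
      = c ^ (r + 2) • G.nbwMatrix (r + 2) + c ^ 2 • aeval (c • G.adjMatrix) (S ℝ r) := by
  have h1 := G.adjMatrix_mul_nbwMatrix_one hG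
  rw [nbwMatrix_one] at h1
  have hx (k : ℕ) : (c • G.adjMatrix) * (c ^ (k + 2) • G.nbwMatrix (k + 2))
      = c ^ (k + 3) • G.nbwMatrix (k + 3) + c ^ (k + 1) • G.nbwMatrix (k + 1) := by
    rw [smul_mul_smul_comm, adjMatrix_mul_nbwMatrix G hG, smul_add, smul_smul]
    congr 2
    · ring
    · linear_combination c ^ (k + 1) * hc
  induction r using Nat.strong_induction_on with
  | _ r ih =>
    match r with
    | 0 =>
      simp only [Nat.cast_zero, zero_add, S_two, S_zero, map_sub, map_one, sq]
      rw [map_mul, aeval_X, smul_mul_smul_comm, h1, smul_add, smul_smul, add_sub_assoc]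
      congr 1
      -- The first backtracking step has weight `q + 1` instead of `q`; the excess is the source of
      -- the term `c ^ 2 • S r`.
      rw [show c * c * ((q + 1 : ℕ) : ℝ) = 1 + c * c by push_cast; linear_combination hc, add_smul,
        one_smul, add_sub_cancel_left]
    | 1 =>
      have h0 := ih 0 (by norm_num)
      have hx0 := hx 0
      simp only [Nat.cast_zero, zero_add, Nat.cast_one, S_zero, map_one, S_one, aeval_X, pow_one,
        nbwMatrix_one] at h0 hx0 ⊢
      rw [show (1 + 2 : ℤ) = 1 + 2 by rfl, S_add_two, map_sub, map_mul, aeval_X, S_one, aeval_X,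
        show (1 + 1 : ℤ) = 2 by norm_num, h0, mul_add, hx0, mul_smul_comm, mul_one]
      abel
    | k + 2 =>
      have h0 := ih k (by omega)
      have h1 := ih (k + 1) (by omega)
      have e1 : S ℝ ((k + 2 : ℕ) + 2) = X * S ℝ ((k + 1 : ℕ) + 2) - S ℝ (k + 2) := by
        rw [S_add_two]; push_cast; ring_nf
      have e2 : S ℝ ((k + 2 : ℕ)) = X * S ℝ ((k + 1 : ℕ)) - S ℝ k := by
        push_cast; rw [S_add_two]
      rw [e1, e2, map_sub, map_sub, map_mul, map_mul, aeval_X, h1, h0, mul_add, hx (k + 1),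
        mul_smul_comm, smul_sub]
      abel

open Polynomial in
theorem sum_eval_eigenvalues (c : ℝ) (P : ℝ[X]) :
    ∑ k, P.eval (c * G.adjMatrix_isHermitian.eigenvalues k)
      = (aeval (c • G.adjMatrix) P).trace := by
  set hA := G.adjMatrix_isHermitian
  have h1 : c • G.adjMatrix = Unitary.conjStarAlgAut ℝ _ hA.eigenvectorUnitary
      (Matrix.diagonal fun k => c * hA.eigenvalues k) := by
    conv_lhs => rw [hA.spectral_theorem]
    rw [← map_smul]
    congr 1
    ext i j
    by_cases h : i = j <;> simp [h]
  have h2 (D : Matrix V V ℝ) :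
      aeval (Unitary.conjStarAlgAut ℝ _ hA.eigenvectorUnitary D) P
        = Unitary.conjStarAlgAut ℝ _ hA.eigenvectorUnitary (aeval D P) :=
    aeval_algHom_apply (Unitary.conjStarAlgAut ℝ _ hA.eigenvectorUnitary).toAlgEquiv.toAlgHom D P
  have h3 (d : V → ℝ) : aeval (Matrix.diagonal d) P = Matrix.diagonal fun k => P.eval (d k) := by
    have := aeval_algHom_apply (Matrix.diagonalAlgHom (n := V) (α := ℝ) ℝ) d P
    simp only [Matrix.diagonalAlgHom_apply] at this
    rw [this]
    congr 1
    ext k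
    simp [← Polynomial.coe_aeval_eq_eval]
  rw [h1, h2, h3, Unitary.conjStarAlgAut_apply, Matrix.trace_mul_comm, ← mul_assoc]
  simp

open Polynomial Polynomial.Chebyshev in
theorem sum_eval_chebyshev_add_two {q : ℕ} (hG : G.IsRegular (q + 1)) {c : ℝ}
    (hc : c ^ 2 * q = 1) {r : ℕ} (hr : ((r + 2 : ℕ) : ℕ∞) < G.girth) :
    ∑ k, (S ℝ (r + 2)).eval (c * G.adjMatrix_isHermitian.eigenvalues k)
      = c ^ 2 * ∑ k, (S ℝ r).eval (c * G.adjMatrix_isHermitian.eigenvalues k) := by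
  rw [sum_eval_eigenvalues, sum_eval_eigenvalues, aeval_chebyshev_adjMatrix G hG hc,
    Matrix.trace_add, Matrix.trace_smul, Matrix.trace_smul, smul_eq_mul, smul_eq_mul]
  simp [Matrix.trace, G.nbwMatrix_diag_eq_zero hr]

open Polynomial in
theorem sum_eigenvalues_eq_zero (c : ℝ) (hr : 1 < G.girth) :
    ∑ k, (X : ℝ[X]).eval (c * G.adjMatrix_isHermitian.eigenvalues k) = 0 := by
  rw [sum_eval_eigenvalues, aeval_X, ← nbwMatrix_one, Matrix.trace_smul]
  simp [Matrix.trace, G.nbwMatrix_diag_eq_zero (r := 0) (by simpa using hr)]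

end NonBacktracking

end Multigraph

/-! ### The semicircle distribution and its Chebyshev integrals -/

/-- `Real.sqrt` vanishes on negative numbers, so the indicator is redundant and the density is
continuous. -/
theorem semicircle_eq_withDensity :
    semicircle = volume.withDensity
      fun x => ENNReal.ofReal (1 / (2 * Real.pi) * Real.sqrt (4 - x ^ 2)) := by
  unfold semicircle
  congr 1
  ext x
  congr 1
  rw [Set.indicator_apply_eq_self]
  intro hx
  rw [Real.sqrt_eq_zero_of_nonpos, mul_zero]
  rw [Set.mem_ofPred_eq, not_le, ← sq_lt_sq₀ (by norm_num) (abs_nonneg _), sq_abs] at hx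
  linarith

theorem sqrt_four_sub_sq_eq_zero {x : ℝ} (hx : x ∉ Set.Ioc (-2 : ℝ) 2) :
    Real.sqrt (4 - x ^ 2) = 0 := by
  apply Real.sqrt_eq_zero_of_nonpos
  rw [Set.mem_Ioc, not_and_or, not_lt, not_le] at hx
  rcases hx with hx | hx <;> nlinarith

theorem integral_semicircle {f : ℝ → ℝ} (hf : Continuous f) :
    ∫ x, f x ∂semicircle
      = 2 / Real.pi * ∫ θ in (0 : ℝ)..Real.pi, f (2 * Real.cos θ) * Real.sin θ ^ 2 := by
  have h0 (x : ℝ) : 0 ≤ 1 / (2 * Real.pi) * Real.sqrt (4 - x ^ 2) := by positivity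
  rw [semicircle_eq_withDensity, integral_withDensity_eq_integral_toReal_smul (by fun_prop)
    (by simp)]
  simp only [ENNReal.toReal_ofReal (h0 _), smul_eq_mul]
  set g : ℝ → ℝ := fun x => 1 / (2 * Real.pi) * Real.sqrt (4 - x ^ 2) * f x with hg
  have hgc : Continuous g := by fun_prop
  have h1 : ∫ x, g x = ∫ x in (-2 : ℝ)..2, g x := by
    rw [intervalIntegral.integral_of_le (by norm_num),
      setIntegral_eq_integral_of_forall_compl_eq_zero]
    intro x hx
    simp [hg, sqrt_four_sub_sq_eq_zero hx]
  have h2 := intervalIntegral.integral_comp_mul_deriv (a := 0) (b := Real.pi)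
    (f := fun θ => 2 * Real.cos θ) (f' := fun θ => 2 * -Real.sin θ) (g := g)
    (fun x _ => (Real.hasDerivAt_cos x).const_mul 2) (by fun_prop) hgc
  simp only [Real.cos_zero, Real.cos_pi, mul_one, mul_neg, Function.comp_apply] at h2
  rw [h1, intervalIntegral.integral_symm, ← h2, ← intervalIntegral.integral_neg,
    ← intervalIntegral.integral_const_mul]
  refine intervalIntegral.integral_congr fun θ hθ => ?_
  rw [Set.uIcc_of_le Real.pi_pos.le] at hθ
  have h3 : Real.sqrt (4 - (2 * Real.cos θ) ^ 2) = 2 * Real.sin θ := by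
    rw [show 4 - (2 * Real.cos θ) ^ 2 = (2 * Real.sin θ) ^ 2 by
      linear_combination (-4) * Real.sin_sq_add_cos_sq θ]
    exact Real.sqrt_sq (mul_nonneg zero_le_two (Real.sin_nonneg_of_mem_Icc hθ))
  simp only [hg, h3]
  field_simp

-- With `x = 2 cos θ`, `S_r(x) sin θ = sin ((r+1)θ)`; the product with the remaining `sin θ` is half
-- of `cos (rθ) - cos ((r+2)θ)`.
open Polynomial.Chebyshev in
theorem integral_chebyshev_semicircle (r : ℕ) :
    ∫ x, (S ℝ r).eval x ∂semicircle = if r = 0 then 1 else 0 := by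
  have hcos (k : ℕ) : ∫ θ in (0 : ℝ)..Real.pi, Real.cos (k * θ) = if k = 0 then Real.pi else 0 := by
    split_ifs with hk
    · simp [hk]
    · rw [intervalIntegral.integral_comp_mul_left _ (by exact_mod_cast hk), integral_cos]
      simp
  have h (θ : ℝ) : (S ℝ r).eval (2 * Real.cos θ) * Real.sin θ ^ 2
      = (Real.cos (r * θ) - Real.cos ((r + 2 : ℕ) * θ)) * (1 / 2) := by
    rw [sq, ← mul_assoc, S_two_mul_real_cos]
    have h1 := Real.cos_sub ((r + 1) * θ) θ
    have h2 := Real.cos_add ((r + 1) * θ) θ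
    rw [show ((r : ℝ) + 1) * θ - θ = r * θ by ring] at h1
    rw [show ((r : ℝ) + 1) * θ + θ = (r + 2 : ℕ) * θ by push_cast; ring] at h2
    rw [h1, h2]
    push_cast
    ring
  rw [integral_semicircle (by fun_prop)]
  simp only [h]
  rw [intervalIntegral.integral_mul_const, intervalIntegral.integral_sub
    (Continuous.intervalIntegrable (by fun_prop) _ _)
    (Continuous.intervalIntegrable (by fun_prop) _ _), hcos, hcos]
  rw [if_neg (by omega : r + 2 ≠ 0)]
  split_ifs
  · field_simp
    simp
  · simp

instance : NullSingletonClass semicircle := by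
  unfold semicircle
  infer_instance

instance : IsProbabilityMeasure semicircle where
  measure_univ := by
    have hi : Integrable fun x : ℝ => 1 / (2 * Real.pi) * Real.sqrt (4 - x ^ 2) := by
      refine Continuous.integrable_of_hasCompactSupport (by fun_prop)
        (HasCompactSupport.intro (isCompact_Icc (a := (-2 : ℝ)) (b := 2)) fun x hx => ?_)
      rw [sqrt_four_sub_sq_eq_zero fun h => hx (Set.Ioc_subset_Icc_self h), mul_zero]
    -- Since `S_0 = 1`, the total mass is the Chebyshev integral of index 0.
    have h := integral_chebyshev_semicircle 0
    rw [semicircle_eq_withDensity, integral_withDensity_eq_integral_toReal_smul (by fun_prop)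
      (by simp)] at h
    rw [semicircle_eq_withDensity, withDensity_apply _ MeasurableSet.univ, Measure.restrict_univ,
      ← ofReal_integral_eq_lintegral_ofReal hi (ae_of_all _ fun x => by positivity)]
    have h0 (x : ℝ) : 0 ≤ 1 / (2 * Real.pi) * Real.sqrt (4 - x ^ 2) := by positivity
    simp only [ENNReal.toReal_ofReal (h0 _), smul_eq_mul, Nat.cast_zero, Polynomial.Chebyshev.S_zero,
      Polynomial.eval_one, mul_one, if_true] at h
    rw [h, ENNReal.ofReal_one]

theorem ae_abs_le_two_semicircle : ∀ᵐ x ∂semicircle, |x| ≤ 2 := by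
  unfold semicircle
  rw [ae_withDensity_iff']
  · refine ae_of_all _ fun x hx => ?_
    by_contra h
    have hx' : x ∉ {x : ℝ | |x| ≤ 2} := h
    exact hx (by rw [Set.indicator_of_notMem hx', ENNReal.ofReal_zero])
  · refine (Measurable.ennreal_ofReal (Measurable.indicator (by fun_prop) ?_)).aemeasurable
    exact measurableSet_le (by fun_prop) (by fun_prop)

/-! ### From Chebyshev polynomials to all polynomials -/

theorem integrable_of_ae_abs_le {μ : Measure ℝ} [IsFiniteMeasure μ] {R : ℝ}
    (hR : ∀ᵐ x ∂μ, |x| ≤ R) {f : ℝ → ℝ} (hf : Continuous f) : Integrable f μ := by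
  obtain ⟨C, hC⟩ := (isCompact_Icc (a := -R) (b := R)).exists_bound_of_continuousOn hf.continuousOn
  refine Integrable.of_bound hf.aestronglyMeasurable C ?_
  filter_upwards [hR] with x hx
  exact hC x (abs_le.1 hx)

open Polynomial Polynomial.Chebyshev in
/-- Polynomials are spanned by the Chebyshev polynomials `S`, so that convergence of the integrals
of the latter implies convergence of the integrals of all polynomials. -/
theorem tendsto_integral_polynomial_of_chebyshev {μs : ℕ → Measure ℝ} {μ : Measure ℝ}
    (hs : ∀ n (P : ℝ[X]), Integrable (fun x => P.eval x) (μs n))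
    (hμ : ∀ P : ℝ[X], Integrable (fun x => P.eval x) μ)
    (h : ∀ r : ℕ, Tendsto (fun n => ∫ x, (S ℝ r).eval x ∂μs n) atTop (𝓝 (∫ x, (S ℝ r).eval x ∂μ)))
    (P : ℝ[X]) :
    Tendsto (fun n => ∫ x, P.eval x ∂μs n) atTop (𝓝 (∫ x, P.eval x ∂μ)) := by
  have hspan : ∀ k : ℕ, (X ^ k : ℝ[X]) ∈ Submodule.span ℝ (Set.range fun r : ℕ => S ℝ r) := by
    intro k
    induction k with
    | zero => exact Submodule.subset_span ⟨0, by simp⟩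
    | succ k ih =>
      rw [pow_succ']
      -- The span is stable under multiplication by `X`, because `X S_{r+1} = S_{r+2} + S_r`.
      refine Submodule.span_induction (p := fun Q _ => X * Q ∈ _) ?_ (by simp) ?_ ?_ ih
      · rintro _ ⟨r, rfl⟩
        rcases r with _ | r
        · exact Submodule.subset_span ⟨1, by simp⟩
        · have : (X * S ℝ (r + 1 : ℕ) : ℝ[X]) = S ℝ (r + 2 : ℕ) + S ℝ r := by
            push_cast
            rw [S_add_two]
            ring
          simp only [this]
          exact add_mem (Submodule.subset_span ⟨_, rfl⟩) (Submodule.subset_span ⟨_, rfl⟩)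
      · intro x y _ _ hx hy
        rw [mul_add]
        exact add_mem hx hy
      · intro a x _ hx
        rw [mul_smul_comm]
        exact Submodule.smul_mem _ a hx
  have hP : P ∈ Submodule.span ℝ (Set.range fun r : ℕ => S ℝ r) := by
    rw [P.as_sum_range_C_mul_X_pow]
    refine Submodule.sum_mem _ fun i _ => ?_
    rw [← smul_eq_C_mul]
    exact Submodule.smul_mem _ _ (hspan i)
  induction hP using Submodule.span_induction with
  | mem x hx => obtain ⟨r, rfl⟩ := hx; exact h r
  | zero => simp
  | add x y _ _ hx hy =>
    simp only [eval_add]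
    simp_rw [fun n => integral_add (hs n x) (hs n y)]
    rw [integral_add (hμ x) (hμ y)]
    exact hx.add hy
  | smul a x _ hx =>
    simp only [eval_smul, smul_eq_mul, integral_const_mul]
    exact hx.const_mul a

/-! ### Chebyshev integrals of the spectral measures -/

namespace Multigraph

variable {V E : Type*} [Fintype V] [DecidableEq V] [Fintype E] (G : Multigraph V E)

theorem integrable_spectralMeasure (q : ℕ) [Nonempty V] (f : ℝ → ℝ) :
    Integrable f (G.spectralMeasure q) := by
  refine Integrable.smul_measure ?_ (by simp)
  rw [integrable_finsetSum_measure]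
  exact fun _ _ => integrable_dirac (by simp)

theorem integral_spectralMeasure (q : ℕ) (f : ℝ → ℝ) :
    ∫ x, f x ∂G.spectralMeasure q = (Fintype.card V : ℝ)⁻¹ *
      ∑ k, f ((q : ℝ) ^ (-(1 / 2 : ℝ)) * G.adjMatrix_isHermitian.eigenvalues k) := by
  rw [spectralMeasure, integral_smul_measure, integral_finsetSum_measure]
  · simp
  · exact fun _ _ => integrable_dirac (by simp)

instance (q : ℕ) [Nonempty V] : IsProbabilityMeasure (G.spectralMeasure q) where
  measure_univ := by
    simp [spectralMeasure, ENNReal.inv_mul_cancel]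

open Polynomial.Chebyshev in
theorem integral_chebyshev_spectralMeasure_add_two {q : ℕ} (hq : q ≠ 0)
    (hG : G.IsRegular (q + 1)) {r : ℕ} (hr : ((r + 2 : ℕ) : ℕ∞) < G.girth) :
    ∫ x, (S ℝ (r + 2)).eval x ∂G.spectralMeasure q
      = (q : ℝ)⁻¹ * ∫ x, (S ℝ r).eval x ∂G.spectralMeasure q := by
  have hc : ((q : ℝ) ^ (-(1 / 2 : ℝ))) ^ 2 = (q : ℝ)⁻¹ := by
    rw [← Real.rpow_natCast, ← Real.rpow_mul (Nat.cast_nonneg _), ← Real.rpow_neg_one]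
    norm_num
  rw [integral_spectralMeasure, integral_spectralMeasure,
    G.sum_eval_chebyshev_add_two hG (by rw [hc]; field_simp) hr, hc]
  ring

end Multigraph

open Polynomial.Chebyshev in
theorem tendsto_integral_chebyshev_spectralMeasure (V E : ℕ → Type*)
    [∀ n, Fintype (V n)] [∀ n, DecidableEq (V n)] [∀ n, Nonempty (V n)] [∀ n, Fintype (E n)]
    (G : ∀ n, Multigraph (V n) (E n)) (q : ℕ → ℕ)
    (hreg : ∀ n, (G n).IsRegular (q n + 1))
    (hdeg : Tendsto (fun n => q n + 1) atTop atTop)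
    (hgirth : Tendsto (fun n => (G n).girth) atTop (𝓝 ⊤)) (r : ℕ) :
    Tendsto (fun n => ∫ x, (S ℝ r).eval x ∂(G n).spectralMeasure (q n)) atTop
      (𝓝 (if r = 0 then 1 else 0)) := by
  have hq : Tendsto q atTop atTop :=
    tendsto_atTop.2 fun b => (tendsto_atTop.1 hdeg (b + 1)).mono fun n hn => by omega
  have hqi : Tendsto (fun n => ((q n : ℕ) : ℝ)⁻¹) atTop (𝓝 0) :=
    tendsto_inv_atTop_zero.comp (tendsto_natCast_atTop_atTop.comp hq)
  have hg (k : ℕ) : ∀ᶠ n in atTop, (k : ℕ∞) < (G n).girth :=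
    hgirth.eventually_const_lt (ENat.natCast_lt_top k)
  induction r using Nat.strong_induction_on with
  | _ r ih =>
    match r with
    | 0 => simp
    | 1 =>
      -- Girth greater than 1 excludes loops, so the adjacency matrix has trace zero.
      refine tendsto_const_nhds.congr' ?_
      filter_upwards [hg 1] with n hn
      rw [Multigraph.integral_spectralMeasure]
      have := (G n).sum_eigenvalues_eq_zero ((q n : ℝ) ^ (-(1 / 2 : ℝ))) (by exact_mod_cast hn)
      simp only [Nat.cast_one, S_one, this]
      simp
    | k + 2 =>
      have h := hqi.mul (ih k (by omega))
      rw [zero_mul] at h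
      refine (h.congr' ?_)
      filter_upwards [hg (k + 2), hq.eventually_ne_atTop 0] with n hn hn0
      push_cast
      rw [(G n).integral_chebyshev_spectralMeasure_add_two hn0 (hreg n) hn]

/-! ### From moments to characteristic and distribution functions -/

/-- The derivative of the remainder of order `n + 1` is `I` times the one of order `n`, so the bound
follows inductively by comparing derivatives. -/
theorem norm_exp_mul_I_sub_sum_le_of_nonneg (n : ℕ) {y : ℝ} (hy : 0 ≤ y) :
    ‖Complex.exp (y * Complex.I)
        - ∑ k ∈ Finset.range n, (y * Complex.I) ^ k / (k.factorial : ℂ)‖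
      ≤ y ^ n / n.factorial := by
  induction n generalizing y with
  | zero => simp [Complex.norm_exp_ofReal_mul_I]
  | succ n ih =>
    have hmul (x : ℝ) : HasDerivAt (fun x : ℝ => (x : ℂ) * Complex.I) Complex.I x := by
      simpa using (Complex.ofRealCLM.hasDerivAt (x := x)).mul_const Complex.I
    have hf (x : ℝ) : HasDerivAt (fun x : ℝ => Complex.exp (x * Complex.I)
        - ∑ k ∈ Finset.range (n + 1), (x * Complex.I) ^ k / (k.factorial : ℂ))
        (Complex.I * (Complex.exp (x * Complex.I)
        - ∑ k ∈ Finset.range n, (x * Complex.I) ^ k / (k.factorial : ℂ))) x := by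
      have hs := HasDerivAt.fun_sum (u := Finset.range (n + 1)) fun k _ =>
        ((hmul x).fun_pow k).div_const (k.factorial : ℂ)
      convert! (hmul x).cexp.sub hs using 1
      rw [Finset.sum_range_succ', mul_sub, mul_comm, Finset.mul_sum]
      simp only [Nat.cast_zero, zero_mul, zero_div, add_zero, Nat.add_sub_cancel]
      congr 1
      refine Finset.sum_congr rfl fun k _ => ?_
      rw [Nat.factorial_succ]
      have h1 : (k.factorial : ℂ) ≠ 0 := by exact_mod_cast k.factorial_ne_zero
      have h2 : ((k : ℂ) + 1) ≠ 0 := by exact_mod_cast k.succ_ne_zero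
      push_cast
      field_simp
    have hB (x : ℝ) : HasDerivAt (fun x : ℝ => x ^ (n + 1) / ((n + 1).factorial : ℝ))
        (x ^ n / n.factorial) x := by
      convert! (hasDerivAt_pow (n + 1) x).div_const ((n + 1).factorial : ℝ) using 1
      rw [Nat.factorial_succ]
      push_cast
      field_simp
    refine image_norm_le_of_norm_deriv_right_le_deriv_boundary
      (fun x _ => (hf x).continuousAt.continuousWithinAt) (fun x _ => (hf x).hasDerivWithinAt)
      ?_ hB (fun x hx => ?_) (Set.right_mem_Icc.2 hy)
    · simp [Finset.sum_range_succ']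
    · rw [norm_mul, Complex.norm_I, one_mul]
      exact ih hx.1

theorem norm_exp_mul_I_sub_sum_le (n : ℕ) (y : ℝ) :
    ‖Complex.exp (y * Complex.I)
        - ∑ k ∈ Finset.range n, (y * Complex.I) ^ k / (k.factorial : ℂ)‖
      ≤ |y| ^ n / n.factorial := by
  rcases le_total 0 y with hy | hy
  · rw [abs_of_nonneg hy]
    exact norm_exp_mul_I_sub_sum_le_of_nonneg n hy
  · rw [abs_of_nonpos hy]
    convert! norm_exp_mul_I_sub_sum_le_of_nonneg n (neg_nonneg.2 hy) using 1
    rw [← Complex.norm_conj]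
    simp [← Complex.exp_conj]

/-- The even order makes the error a genuine moment rather than an absolute one. -/
theorem norm_charFun_sub_sum_le {ν : Measure ℝ} [IsFiniteMeasure ν]
    (hν : ∀ k : ℕ, Integrable (fun x => x ^ k) ν) (t : ℝ) (N : ℕ) :
    ‖charFun ν t - ∑ k ∈ Finset.range (2 * N),
        (t * Complex.I) ^ k / (k.factorial : ℂ) * ((∫ x, x ^ k ∂ν : ℝ) : ℂ)‖
      ≤ t ^ (2 * N) / (2 * N).factorial * ∫ x, x ^ (2 * N) ∂ν := by
  have hi (k : ℕ) : Integrable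
      (fun x : ℝ => (t * Complex.I) ^ k / (k.factorial : ℂ) * ((x ^ k : ℝ) : ℂ)) ν :=
    (hν k).ofReal.const_mul _
  have he : Integrable (fun x : ℝ => Complex.exp (t * x * Complex.I)) ν := by
    refine Integrable.of_bound (by fun_prop) 1 (ae_of_all _ fun x => ?_)
    rw [← Complex.ofReal_mul, Complex.norm_exp_ofReal_mul_I]
  have h : ∑ k ∈ Finset.range (2 * N), (t * Complex.I) ^ k / (k.factorial : ℂ)
        * ((∫ x, x ^ k ∂ν : ℝ) : ℂ)
      = ∫ x : ℝ, ∑ k ∈ Finset.range (2 * N), (t * Complex.I) ^ k / (k.factorial : ℂ)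
        * ((x ^ k : ℝ) : ℂ) ∂ν := by
    rw [integral_finsetSum _ fun k _ => hi k]
    refine Finset.sum_congr rfl fun k _ => ?_
    rw [integral_const_mul, integral_complex_ofReal]
  rw [charFun_apply_real, h, ← integral_sub he (integrable_finsetSum _ fun k _ => hi k),
    ← integral_const_mul]
  refine norm_integral_le_of_norm_le ((hν _).const_mul _) (ae_of_all _ fun x => ?_)
  have h2 := norm_exp_mul_I_sub_sum_le (2 * N) (t * x)
  rw [(even_two_mul N).pow_abs, mul_pow] at h2
  convert! h2 using 1
  · push_cast
    congr 2
    refine Finset.sum_congr rfl fun k _ => ?_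
    ring
  · ring

/-- The order `N` is chosen from the limit alone, whose Taylor error is at most `(tR)^(2N)/(2N)!`.
Convergence of the `2N`-th moments then controls the error for `μs n`, so no common bound on the
supports is needed. -/
theorem tendsto_charFun_of_tendsto_moments {μs : ℕ → Measure ℝ} {μ : Measure ℝ}
    [∀ n, IsFiniteMeasure (μs n)] [IsProbabilityMeasure μ]
    (hs : ∀ n (k : ℕ), Integrable (fun x => x ^ k) (μs n)) {R : ℝ} (hR : ∀ᵐ x ∂μ, |x| ≤ R)
    (h : ∀ k : ℕ, Tendsto (fun n => ∫ x, x ^ k ∂μs n) atTop (𝓝 (∫ x, x ^ k ∂μ))) (t : ℝ) :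
    Tendsto (fun n => charFun (μs n) t) atTop (𝓝 (charFun μ t)) := by
  have hμ (k : ℕ) : Integrable (fun x => x ^ k) μ := integrable_of_ae_abs_le hR (by fun_prop)
  have hmom (N : ℕ) : ∫ x, x ^ (2 * N) ∂μ ≤ R ^ (2 * N) := by
    calc ∫ x, x ^ (2 * N) ∂μ ≤ ∫ _, R ^ (2 * N) ∂μ := by
          refine integral_mono_ae (hμ _) (integrable_const _) ?_
          filter_upwards [hR] with x hx
          rw [← (even_two_mul N).pow_abs]
          exact pow_le_pow_left₀ (abs_nonneg x) hx _
      _ = R ^ (2 * N) := by simp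
  rw [Metric.tendsto_atTop']
  intro ε hε
  obtain ⟨N, hN⟩ : ∃ N : ℕ, (t * R) ^ (2 * N) / (2 * N).factorial < ε / 4 :=
    (((FloorSemiring.tendsto_pow_div_factorial_atTop (t * R)).comp
      (tendsto_id.const_mul_atTop' two_pos)).eventually_lt_const (by positivity)).exists
  set c : ℝ := t ^ (2 * N) / (2 * N).factorial
  have hc : 0 ≤ c := div_nonneg ((even_two_mul N).pow_nonneg t) (by positivity)
  have hlim : c * ∫ x, x ^ (2 * N) ∂μ < ε / 4 := by
    refine lt_of_le_of_lt (mul_le_mul_of_nonneg_left (hmom N) hc) ?_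
    rwa [mul_pow, mul_div_right_comm] at hN
  have hev := ((h (2 * N)).const_mul c).eventually_lt_const hlim
  have hsum := tendsto_finsetSum (Finset.range (2 * N)) fun k _ =>
    ((Complex.continuous_ofReal.tendsto _).comp (h k)).const_mul
      ((t * Complex.I) ^ k / (k.factorial : ℂ))
  have hev2 := (Metric.tendsto_nhds.1 hsum) (ε / 4) (by positivity)
  obtain ⟨n₀, hn₀⟩ := eventually_atTop.1 (hev.and hev2)
  refine ⟨n₀, fun n hn => ?_⟩
  obtain ⟨h1, h2⟩ := hn₀ n hn.le
  have h3 := norm_charFun_sub_sum_le (hs n) t N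
  have h4 := norm_charFun_sub_sum_le hμ t N
  rw [← dist_eq_norm] at h3 h4
  rw [dist_comm] at h4
  simp only [Function.comp_apply] at h2
  have h5 := dist_triangle4 (charFun (μs n) t) _ _ (charFun μ t) |>.trans
    (add_le_add (add_le_add h3 h2.le) h4)
  linarith

theorem tendsto_cdf_of_tendsto_moments {μs : ℕ → Measure ℝ} {μ : Measure ℝ}
    [∀ n, IsProbabilityMeasure (μs n)] [IsProbabilityMeasure μ] [NullSingletonClass μ]
    (hs : ∀ n (k : ℕ), Integrable (fun x => x ^ k) (μs n)) {R : ℝ} (hR : ∀ᵐ x ∂μ, |x| ≤ R)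
    (h : ∀ k : ℕ, Tendsto (fun n => ∫ x, x ^ k ∂μs n) atTop (𝓝 (∫ x, x ^ k ∂μ))) (x : ℝ) :
    Tendsto (fun n => ProbabilityTheory.cdf (μs n) x) atTop (𝓝 (ProbabilityTheory.cdf μ x)) := by
  let νs : ℕ → ProbabilityMeasure ℝ := fun n => ⟨μs n, inferInstance⟩
  let ν : ProbabilityMeasure ℝ := ⟨μ, inferInstance⟩
  have hw : Tendsto νs atTop (𝓝 ν) :=
    ProbabilityMeasure.tendsto_iff_tendsto_charFun.2 (tendsto_charFun_of_tendsto_moments hs hR h)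
  -- The frontier `{x}` is null because `μ` has no atoms.
  have := ProbabilityMeasure.tendsto_measure_of_null_frontier_of_tendsto' hw (E := Set.Iic x)
    (by simp [ν])
  simp only [ProbabilityTheory.cdf_eq_real]
  exact (ENNReal.tendsto_toReal (measure_ne_top _ _)).comp this

/-! ### Quantile functions -/

/-- The quantile function of a measure on the real line. -/
noncomputable def quantile (μ : Measure ℝ) (u : ℝ) : ℝ :=
  sInf {x | u ≤ ProbabilityTheory.cdf μ x}

section Quantile

variable {μ : Measure ℝ}

/-- For `u` in `(0,1)` the set is nonempty and bounded below, and right continuity of the cdf makes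
the infimum attained. -/
theorem quantile_le_iff {u : ℝ} (hu : u ∈ Set.Ioo (0 : ℝ) 1) {x : ℝ} :
    quantile μ u ≤ x ↔ u ≤ ProbabilityTheory.cdf μ x := by
  have hbdd : BddBelow {x | u ≤ ProbabilityTheory.cdf μ x} := by
    obtain ⟨a, ha⟩ :=
      ((ProbabilityTheory.tendsto_cdf_atBot μ).eventually_lt_const hu.1).exists
    refine ⟨a, fun y hy => ?_⟩
    by_contra hya
    exact absurd (hy.trans (ProbabilityTheory.monotone_cdf μ (not_le.1 hya).le)) ha.not_ge
  have hne : {x | u ≤ ProbabilityTheory.cdf μ x}.Nonempty :=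
    ((ProbabilityTheory.tendsto_cdf_atTop μ).eventually_const_le hu.2).exists
  refine ⟨fun h => ?_, fun h => csInf_le hbdd h⟩
  refine le_trans ?_ (ProbabilityTheory.monotone_cdf μ h)
  have hr := ((ProbabilityTheory.cdf μ).right_continuous (quantile μ u)).mono
    Set.Ioi_subset_Ici_self
  refine ge_of_tendsto hr.tendsto ?_
  filter_upwards [self_mem_nhdsWithin] with y hy
  obtain ⟨z, hz, hzy⟩ := exists_lt_of_csInf_lt hne hy
  exact le_trans hz (ProbabilityTheory.monotone_cdf μ hzy.le)

theorem monotoneOn_quantile : MonotoneOn (quantile μ) (Set.Ioo 0 1) := fun _ hu _ hv huv =>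
  (quantile_le_iff hu).2 (huv.trans ((quantile_le_iff hv).1 le_rfl))

theorem aemeasurable_quantile : AEMeasurable (quantile μ) (volume.restrict (Set.Ioo 0 1)) :=
  aemeasurable_restrict_of_monotoneOn measurableSet_Ioo monotoneOn_quantile

theorem map_quantile [IsProbabilityMeasure μ] :
    (volume.restrict (Set.Ioo 0 1)).map (quantile μ) = μ := by
  refine Measure.ext_of_Iic _ _ fun x => ?_
  rw [Measure.map_apply_of_aemeasurable aemeasurable_quantile measurableSet_Iic,
    Measure.restrict_apply' measurableSet_Ioo, ← ProbabilityTheory.ofReal_cdf]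
  have h0 := ProbabilityTheory.cdf_nonneg μ x
  have h1 := ProbabilityTheory.cdf_le_one μ x
  have h : quantile μ ⁻¹' Set.Iic x ∩ Set.Ioo 0 1
      = Set.Iic (ProbabilityTheory.cdf μ x) ∩ Set.Ioo 0 1 := by
    ext u
    refine and_congr_left fun hu => ?_
    exact quantile_le_iff hu
  -- Sandwiching between an open and a half-open interval avoids deciding whether the endpoint
  -- belongs, which fails when the cdf equals 1.
  have h2 : Set.Ioo 0 (ProbabilityTheory.cdf μ x)
      ⊆ Set.Iic (ProbabilityTheory.cdf μ x) ∩ Set.Ioo 0 1 :=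
    fun u hu => ⟨hu.2.le, hu.1, hu.2.trans_le h1⟩
  have h3 : Set.Iic (ProbabilityTheory.cdf μ x) ∩ Set.Ioo 0 1
      ⊆ Set.Ioc 0 (ProbabilityTheory.cdf μ x) := fun u hu => ⟨hu.2.1, hu.1⟩
  rw [h]
  refine le_antisymm ((measure_mono h3).trans_eq ?_) (le_trans (Eq.le ?_) (measure_mono h2))
  · rw [Real.volume_Ioc, sub_zero]
  · rw [Real.volume_Ioo, sub_zero]

theorem tendsto_quantile {μs : ℕ → Measure ℝ}
    (h : ∀ x, Tendsto (fun n => ProbabilityTheory.cdf (μs n) x) atTop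
      (𝓝 (ProbabilityTheory.cdf μ x))) {u : ℝ} (hu : u ∈ Set.Ioo (0 : ℝ) 1)
    (hc : ContinuousWithinAt (quantile μ) (Set.Ioo 0 1) u) :
    Tendsto (fun n => quantile (μs n) u) atTop (𝓝 (quantile μ u)) := by
  refine tendsto_order.2 ⟨fun a ha => ?_, fun b hb => ?_⟩
  · rw [← not_le, quantile_le_iff hu, not_le] at ha
    filter_upwards [(h a).eventually_lt_const ha] with n hn
    rwa [← not_le, quantile_le_iff hu, not_le]
  -- Only the upper bound uses continuity at `u`: a point `v > u` with quantile below `b'` makes `u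
  -- < cdf μ b'` strict.
  · obtain ⟨b', hb', hbb'⟩ := exists_between hb
    have hcont : ContinuousAt (quantile μ) u := hc.continuousAt (Ioo_mem_nhds hu.1 hu.2)
    have hev : ∀ᶠ v in 𝓝[>] u, v ∈ Set.Ioo (0 : ℝ) 1 ∧ quantile μ v < b' :=
      nhdsWithin_le_nhds (Filter.inter_mem (Ioo_mem_nhds hu.1 hu.2)
        (hcont.eventually_lt_const hb'))
    obtain ⟨v, ⟨hv, hvb⟩, huv⟩ := (hev.and self_mem_nhdsWithin).exists
    have hub : u < ProbabilityTheory.cdf μ b' :=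
      lt_of_lt_of_le huv ((quantile_le_iff hv).1 hvb.le)
    filter_upwards [(h b').eventually_const_lt hub] with n hn
    exact ((quantile_le_iff hu).2 hn.le).trans_lt hbb'

theorem ae_tendsto_quantile {μs : ℕ → Measure ℝ}
    (h : ∀ x, Tendsto (fun n => ProbabilityTheory.cdf (μs n) x) atTop
      (𝓝 (ProbabilityTheory.cdf μ x))) :
    ∀ᵐ u ∂volume.restrict (Set.Ioo (0 : ℝ) 1),
      Tendsto (fun n => quantile (μs n) u) atTop (𝓝 (quantile μ u)) := by
  have hc := (monotoneOn_quantile (μ := μ)).countable_not_continuousWithinAt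
  rw [ae_restrict_iff' measurableSet_Ioo]
  filter_upwards [hc.ae_notMem volume] with u hu hu'
  refine tendsto_quantile h hu' ?_
  by_contra hcu
  exact hu ⟨hu', hcu⟩

end Quantile

/-! ### Wasserstein convergence through the quantile coupling -/

theorem wassersteinDist_le_eLpNorm_quantile {p : ℝ} (hp : 0 < p) (μ ν : Measure ℝ)
    [IsProbabilityMeasure μ] [IsProbabilityMeasure ν] :
    wassersteinDist p μ ν ≤ eLpNorm (fun u => quantile μ u - quantile ν u) (ENNReal.ofReal p)
      (volume.restrict (Set.Ioo 0 1)) := by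
  have hm := (aemeasurable_quantile (μ := μ)).prodMk (aemeasurable_quantile (μ := ν))
  have hγ : IsCoupling μ ν ((volume.restrict (Set.Ioo (0 : ℝ) 1)).map
      fun u => (quantile μ u, quantile ν u)) := by
    constructor
    · rw [AEMeasurable.map_map_of_aemeasurable measurable_fst.aemeasurable hm]
      exact map_quantile
    · rw [AEMeasurable.map_map_of_aemeasurable measurable_snd.aemeasurable hm]
      exact map_quantile
  refine (iInf₂_le _ hγ).trans_eq ?_
  rw [lintegral_map' (by fun_prop) hm, eLpNorm_eq_lintegral_rpow_enorm_toReal (by simpa using hp)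
    ENNReal.ofReal_ne_top, ENNReal.toReal_ofReal hp.le]
  simp only [← ENNReal.ofReal_rpow_of_nonneg (abs_nonneg _) hp.le, Real.enorm_eq_ofReal_abs]

theorem ENNReal.pow_le_min_pow_add_div (t : ℝ≥0∞) {K : ℝ≥0∞} (hK : K ≠ 0) (hK' : K ≠ ∞) (N : ℕ) :
    t ^ N ≤ min t K ^ N + t ^ (2 * N) / K ^ N := by
  rcases le_total t K with h | h
  · rw [min_eq_left h]
    exact le_self_add
  · refine le_add_left ?_
    rw [ENNReal.le_div_iff_mul_le (.inl (pow_ne_zero _ hK)) (.inl (ENNReal.pow_ne_top hK')),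
      two_mul, pow_add]
    gcongr

theorem ENNReal.add_pow_le_two_pow_mul (a b : ℝ≥0∞) (k : ℕ) :
    (a + b) ^ k ≤ 2 ^ k * (a ^ k + b ^ k) := by
  calc (a + b) ^ k ≤ (2 * max a b) ^ k := by
        gcongr
        rw [two_mul]
        exact add_le_add (le_max_left _ _) (le_max_right _ _)
    _ ≤ 2 ^ k * (a ^ k + b ^ k) := by
        rw [mul_pow]
        gcongr
        rcases le_total a b with h | h
        · rw [max_eq_right h]; exact le_add_self
        · rw [max_eq_left h]; exact le_self_add

/-- Truncation at `K`: the bounded part tends to 0 by dominated convergence, and the excess is at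
most `D / K ^ N` by the bound on `2N`-th moments. -/
theorem tendsto_lintegral_enorm_quantile_sub_pow {μs : ℕ → Measure ℝ} {μ : Measure ℝ}
    [∀ n, IsProbabilityMeasure (μs n)] [IsProbabilityMeasure μ]
    (h : ∀ x, Tendsto (fun n => ProbabilityTheory.cdf (μs n) x) atTop
      (𝓝 (ProbabilityTheory.cdf μ x))) {N : ℕ} (hN : N ≠ 0) {C : ℝ≥0∞} (hC : C ≠ ∞)
    (hs : ∀ᶠ n in atTop, ∫⁻ x, ‖x‖ₑ ^ (2 * N) ∂μs n ≤ C) (hμ : ∫⁻ x, ‖x‖ₑ ^ (2 * N) ∂μ ≤ C) :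
    Tendsto (fun n => ∫⁻ u in Set.Ioo (0 : ℝ) 1, ‖quantile (μs n) u - quantile μ u‖ₑ ^ N)
      atTop (𝓝 0) := by
  have hm (n : ℕ) : AEMeasurable (fun u => ‖quantile (μs n) u - quantile μ u‖ₑ)
      (volume.restrict (Set.Ioo 0 1)) :=
    (aemeasurable_quantile.sub aemeasurable_quantile).enorm
  have hmom (ν : Measure ℝ) [IsProbabilityMeasure ν] :
      ∫⁻ u in Set.Ioo (0 : ℝ) 1, ‖quantile ν u‖ₑ ^ (2 * N) = ∫⁻ x, ‖x‖ₑ ^ (2 * N) ∂ν := by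
    conv_rhs => rw [← map_quantile (μ := ν)]
    rw [lintegral_map' (by fun_prop) aemeasurable_quantile]
  set D : ℝ≥0∞ := 2 ^ (2 * N) * (C + C) with hD
  have hDtop : D ≠ ∞ := by finiteness
  have hbound : ∀ᶠ n in atTop,
      ∫⁻ u in Set.Ioo (0 : ℝ) 1, ‖quantile (μs n) u - quantile μ u‖ₑ ^ (2 * N) ≤ D := by
    filter_upwards [hs] with n hn
    calc _ ≤ ∫⁻ u in Set.Ioo (0 : ℝ) 1,
          2 ^ (2 * N) * (‖quantile (μs n) u‖ₑ ^ (2 * N) + ‖quantile μ u‖ₑ ^ (2 * N)) := by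
          refine lintegral_mono fun u => ?_
          refine le_trans ?_ (ENNReal.add_pow_le_two_pow_mul _ _ _)
          gcongr
          exact enorm_sub_le
      _ ≤ D := by
          rw [lintegral_const_mul' _ _ (by finiteness), lintegral_add_left'
            (aemeasurable_quantile.enorm.pow_const _), hmom, hmom]
          exact mul_le_mul_right (add_le_add hn hμ) _
  have hmin (K : ℝ≥0∞) (hK : K ≠ ∞) : Tendsto (fun n => ∫⁻ u in Set.Ioo (0 : ℝ) 1,
      min ‖quantile (μs n) u - quantile μ u‖ₑ K ^ N) atTop (𝓝 0) := by
    have := tendsto_lintegral_of_dominated_convergence'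
      (μ := volume.restrict (Set.Ioo (0 : ℝ) 1))
      (F := fun n u => min ‖quantile (μs n) u - quantile μ u‖ₑ K ^ N)
      (f := fun _ => 0) (fun _ => K ^ N) (fun n => ((hm n).min aemeasurable_const).pow_const _)
      (fun n => ae_of_all _ fun u => pow_le_pow_left' (min_le_right _ _) _)
      (by simpa using ENNReal.pow_ne_top hK) ?_
    · simpa using this
    · filter_upwards [ae_tendsto_quantile h] with u hu
      have h1 : Tendsto (fun n => ‖quantile (μs n) u - quantile μ u‖ₑ) atTop (𝓝 0) := by
        simpa [Function.comp_def] using (continuous_enorm.tendsto _).comp (hu.sub_const (quantile μ u))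
      have h2 := ENNReal.Tendsto.pow (n := N) (h1.min (tendsto_const_nhds (x := K)))
      simpa [hN] using h2
  refine ENNReal.tendsto_nhds_zero.2 fun ε hε => ?_
  have hK0 : Tendsto (fun K : ℕ => D / (K : ℝ≥0∞) ^ N) atTop (𝓝 0) := by
    have := ENNReal.Tendsto.const_div (a := D) (ENNReal.Tendsto.pow (n := N)
      ENNReal.tendsto_nat_nhds_top) (.inr hDtop)
    simpa [hN] using this
  obtain ⟨K, hKε, hK1⟩ := ((hK0.eventually_le_const (ENNReal.half_pos hε.ne')).and
    (eventually_ge_atTop 1)).exists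
  have hKne : (K : ℝ≥0∞) ≠ 0 := by exact_mod_cast (by omega : K ≠ 0)
  filter_upwards [hbound, (hmin K (by simp)).eventually_le_const (ENNReal.half_pos hε.ne')]
    with n hn1 hn2
  calc _ ≤ ∫⁻ u in Set.Ioo (0 : ℝ) 1, (min ‖quantile (μs n) u - quantile μ u‖ₑ K ^ N
        + ‖quantile (μs n) u - quantile μ u‖ₑ ^ (2 * N) / (K : ℝ≥0∞) ^ N) :=
        lintegral_mono fun u => ENNReal.pow_le_min_pow_add_div _ hKne (by simp) N
    _ ≤ ε / 2 + ε / 2 := by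
        rw [lintegral_add_left' (((hm n).min aemeasurable_const).pow_const _)]
        refine add_le_add hn2 (le_trans ?_ hKε)
        simp only [div_eq_mul_inv]
        rw [lintegral_mul_const' _ _ (by simp [hKne])]
        gcongr
    _ = ε := ENNReal.add_halves ε

theorem tendsto_wassersteinDist {μs : ℕ → Measure ℝ} {μ : Measure ℝ}
    [∀ n, IsProbabilityMeasure (μs n)] [IsProbabilityMeasure μ]
    (h : ∀ x, Tendsto (fun n => ProbabilityTheory.cdf (μs n) x) atTop
      (𝓝 (ProbabilityTheory.cdf μ x)))
    (hs : ∀ N : ℕ, ∃ C ≠ ∞, (∀ᶠ n in atTop, ∫⁻ x, ‖x‖ₑ ^ (2 * N) ∂μs n ≤ C) ∧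
      ∫⁻ x, ‖x‖ₑ ^ (2 * N) ∂μ ≤ C) {p : ℝ} (hp : 0 < p) :
    Tendsto (fun n => wassersteinDist p (μs n) μ) atTop (𝓝 0) := by
  -- An integer exponent above `p` suffices, as `L^p` norms on `(0,1)` increase with the exponent.
  obtain ⟨N, hN⟩ := exists_nat_gt p
  have hN0 : N ≠ 0 := by
    rintro rfl
    exact absurd (hp.trans hN) (by simp)
  obtain ⟨C, hC, hC1, hC2⟩ := hs N
  have h1 := tendsto_lintegral_enorm_quantile_sub_pow h hN0 hC hC1 hC2
  have h2 := h1.ennrpow_const (1 / (N : ℝ))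
  rw [ENNReal.zero_rpow_of_pos (by positivity)] at h2
  have : IsProbabilityMeasure (volume.restrict (Set.Ioo (0 : ℝ) 1)) := ⟨by simp⟩
  refine tendsto_of_tendsto_of_tendsto_of_le_of_le tendsto_const_nhds h2 (fun _ => zero_le)
    fun n => ?_
  refine (wassersteinDist_le_eLpNorm_quantile hp _ _).trans ?_
  refine (eLpNorm_le_eLpNorm_of_exponent_le (q := (N : ℝ≥0∞)) ?_
    (aemeasurable_quantile.sub aemeasurable_quantile).aestronglyMeasurable).trans_eq ?_
  · rw [← ENNReal.ofReal_natCast]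
    exact ENNReal.ofReal_le_ofReal hN.le
  · rw [eLpNorm_eq_lintegral_rpow_enorm_toReal (by exact_mod_cast hN0) (by simp)]
    simp

theorem lintegral_enorm_pow_eq_ofReal {ν : Measure ℝ} {N : ℕ}
    (hν : Integrable (fun x => x ^ (2 * N)) ν) :
    ∫⁻ x, ‖x‖ₑ ^ (2 * N) ∂ν = ENNReal.ofReal (∫ x, x ^ (2 * N) ∂ν) := by
  rw [ofReal_integral_eq_lintegral_ofReal hν (ae_of_all _ fun x => (even_two_mul N).pow_nonneg x)]
  refine lintegral_congr fun x => ?_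
  rw [← (even_two_mul N).pow_abs x, ENNReal.ofReal_pow (abs_nonneg x), Real.enorm_eq_ofReal_abs]

theorem tendsto_wassersteinDist_of_tendsto_moments {μs : ℕ → Measure ℝ} {μ : Measure ℝ}
    [∀ n, IsProbabilityMeasure (μs n)] [IsProbabilityMeasure μ] [NullSingletonClass μ]
    (hs : ∀ n (k : ℕ), Integrable (fun x => x ^ k) (μs n)) {R : ℝ} (hR : ∀ᵐ x ∂μ, |x| ≤ R)
    (h : ∀ k : ℕ, Tendsto (fun n => ∫ x, x ^ k ∂μs n) atTop (𝓝 (∫ x, x ^ k ∂μ)))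
    {p : ℝ} (hp : 0 < p) :
    Tendsto (fun n => wassersteinDist p (μs n) μ) atTop (𝓝 0) := by
  refine tendsto_wassersteinDist (tendsto_cdf_of_tendsto_moments hs hR h) (fun N => ?_) hp
  refine ⟨ENNReal.ofReal (∫ x, x ^ (2 * N) ∂μ + 1), ENNReal.ofReal_ne_top, ?_, ?_⟩
  · filter_upwards [(h (2 * N)).eventually_lt_const (lt_add_one _)] with n hn
    rw [lintegral_enorm_pow_eq_ofReal (hs n _)]
    exact ENNReal.ofReal_le_ofReal hn.le
  · rw [lintegral_enorm_pow_eq_ofReal (integrable_of_ae_abs_le hR (by fun_prop))]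
    exact ENNReal.ofReal_le_ofReal (lt_add_one _).le

theorem memWassersteinSpace_of_integrable {p : ℝ} {μ : Measure ℝ} [IsProbabilityMeasure μ]
    (h : Integrable (fun x => |x| ^ p) μ) : MemWassersteinSpace p μ :=
  ⟨inferInstance, h.lintegral_lt_top⟩

theorem corollary4p1
    (V E : ℕ → Type*)
    [∀ n, Fintype (V n)] [∀ n, DecidableEq (V n)] [∀ n, Nonempty (V n)] [∀ n, Fintype (E n)]
    (G : ∀ n, Multigraph (V n) (E n)) (q : ℕ → ℕ)
    (hreg : ∀ n, (G n).IsRegular (q n + 1))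
    (hdeg : Tendsto (fun n => q n + 1) atTop atTop)
    (hgirth : Tendsto (fun n => (G n).girth) atTop (𝓝 ⊤)) :
    ∀ p : ℝ, 1 ≤ p →
      TendstoInWassersteinSpace p (fun n => (G n).spectralMeasure (q n)) semicircle := by
  intro p hp
  have hp0 : 0 < p := one_pos.trans_le hp
  refine ⟨fun n => memWassersteinSpace_of_integrable ((G n).integrable_spectralMeasure _ _),
    memWassersteinSpace_of_integrable (integrable_of_ae_abs_le ae_abs_le_two_semicircle
      (continuous_abs.rpow_const fun _ => .inr hp0.le)), ?_⟩
  refine tendsto_wassersteinDist_of_tendsto_moments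
    (fun n k => (G n).integrable_spectralMeasure _ _) ae_abs_le_two_semicircle (fun k => ?_) hp0
  have := tendsto_integral_polynomial_of_chebyshev
    (fun n P => (G n).integrable_spectralMeasure (q n) _)
    (fun P => integrable_of_ae_abs_le ae_abs_le_two_semicircle P.continuous)
    (fun r => by
      rw [integral_chebyshev_semicircle]
      exact tendsto_integral_chebyshev_spectralMeasure V E G q hreg hdeg hgirth r)
    (Polynomial.X ^ k)
  simpa using this
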